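/- Let $T=(V,E)$ be a finite tree with root $v_0$. Each non-root node $v_e$ is identified with the link $e\in E$ joining its parent to it, and a receiver is attached to every leaf. Link $e$ has pass rate $\alpha_e\in(0,1]$. Independent probes are sent from $v_0$; link $e$ passes each probe with probability $\alpha_e$, independently over links and probes, and a probe reaches a node iff every link on the path from $v_0$ to that node passes it. Put $\bar\alpha_e=1-\alpha_e$ and $\|\bar\alpha\|=\max_{e\in E}|\bar\alpha_e|$. For a node $k$ let $A_k=\prod_e\alpha_e$ and $s_k=\sum_e\bar\alpha_e$, both over the links $e$ on the path from $v_0$ to $v_k$ (including the link into $v_k$), and let $d_k$ be the set of children of $k$. A probe is observed by $j\in d_k$ if it reaches at least one receiver in the subtree hanging from the link into $j$. For $x\subseteq d_k$ with $\#(x)\ge 2$ let $I_k(x)$ be the number of the first $n$ probes that are observed by every member of $x$, let $\hat\gamma_j=I_k(\{j\})/n$ for $j\in x$, and let $$lm_k(x)=\frac{\prod_{j\in x}\hat\gamma_j}{I_k(x)/n}$$ be the local estimator (of $A_k^{\#(x)-1}$), with the value $0$ if $I_k(x)=0$. Then for all $T$, $k$ and $x\subseteq d_k$ with $\#(x)\ge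 2$: (a) For every $\alpha\in(0,1]^E$, as $n\to\infty$, $\sqrt n\,\big(lm_k(x)^{1/(\#(x)-1)}-A_k\big)$ converges in distribution to a Gaussian of mean $0$ and variance $v(\alpha)$, where $v(\alpha)=s_k+O(\|\bar\alpha\|^2)$ as $\bar\alpha\to0$; that is, the local estimate $lm_k(x)^{1/(\#(x)-1)}$ of $A_k$ has asymptotic variance $s_k+O(\|\bar\alpha\|^2)$ (for $\#(x)=2$ this estimate is $lm_k(x)$ itself). (b) For every $\alpha\in(0,1]^E$, as $n\to\infty$, $\sqrt n\,\big(lm_k(x)-A_k^{\#(x)-1}\big)$ converges in distribution to a Gaussian of mean $0$ and variance $w(\alpha)$, where $w(\alpha)=(\#(x)-1)^2s_k+O(\|\bar\alpha\|^2)$ as $\bar\alpha\to0$. A Gaussian of variance $0$ is the point mass at its mean, and the constants in the $O$-terms depend only on $T$, $k$ and $x$. -/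

import Mathlib

open Filter Topology MeasureTheory ProbabilityTheory
open scoped NNReal

/-- A rooted (multicast) tree with node set `V`, given by its root and its parent map. The value of
the parent map at the root is a convention. -/
structure MulticastTree (V : Type*) where
  root : V
  parent : V → V
  parent_root : parent root = root
  exists_iterate_eq_root : ∀ v, ∃ l : ℕ, parent^[l] v = root

namespace MulticastTree

variable {V : Type*} (T : MulticastTree V)

/-- The links: the link into the non-root node `v` (from the parent of `v`) is named by `v`. -/
abbrev Link : Type _ := {v : V // v ≠ T.root}

/-- `u` lies on the path from the root to `v` (both ends included). -/
def OnPath (u v : V) : Prop := ∃ l : ℕ, T.parent^[l] v = u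

/-- `j` is a descendant (child) of `k`. -/
def IsChild (j k : V) : Prop := j ≠ T.root ∧ T.parent j = k

/-- The leaf nodes; a receiver is attached to each of them. -/
def IsLeaf (r : V) : Prop := ∀ j, ¬ T.IsChild j r

section Finite

variable [Fintype V]

open Classical in
/-- The set `d_k` of descendants (children) of node `k`. -/
noncomputable def children (k : V) : Finset V := Finset.univ.filter fun j => T.IsChild j k

open Classical in
/-- The links on the path from the root to `k`, including the link into `k`. -/
noncomputable def pathLinks (k : V) : Finset T.Link :=
  Finset.univ.filter fun e => T.OnPath e.1 k

/-- `A_k`: the pass rate of the path from the root to `k`, for link pass rates `α`. -/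
noncomputable def pathPassRate (α : T.Link → ℝ) (k : V) : ℝ := ∏ e ∈ T.pathLinks k, α e

/-- `s_k`: the sum of the link loss rates over the path from the root to `k`. -/
noncomputable def pathLossSum (α : T.Link → ℝ) (k : V) : ℝ := ∑ e ∈ T.pathLinks k, (1 - α e)

end Finite

/-- For one probe, with `z e = true` when link `e` passes: the probe reaches node `v`. -/
def Reaches (z : T.Link → Bool) (v : V) : Prop := ∀ e : T.Link, T.OnPath e.1 v → z e = true

/-- For one probe: it is observed by the descendant `j`, that is, by at least one receiver
attached to the subtree hanging from the link into `j`. -/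
def Observed (z : T.Link → Bool) (j : V) : Prop :=
  ∃ r, T.IsLeaf r ∧ T.OnPath j r ∧ T.Reaches z r

section Estimator

variable {Ω : Type*} (Z : ℕ → T.Link → Ω → Bool)

open Classical in
/-- `I_k(x)`: the number of the first `n` probes observed by all members of `x`. Here `Z i e` tells
whether link `e` passes probe `i`. -/
noncomputable def coObs (x : Finset V) (n : ℕ) (ω : Ω) : ℕ :=
  ((Finset.range n).filter fun i => ∀ j ∈ x, T.Observed (fun e => Z i e ω) j).card

/-- `γ̂_x = I_k(x) / n`: the empirical probability of joint observation by the members of `x`. -/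
noncomputable def empRate (x : Finset V) (n : ℕ) (ω : Ω) : ℝ := (T.coObs Z x n ω : ℝ) / n

/-- The local estimator `lm_k(x) = (∏_{j ∈ x} γ̂_j) / (I_k(x) / n)`. -/
noncomputable def localEstimator (x : Finset V) (n : ℕ) (ω : Ω) : ℝ :=
  (∏ j ∈ x, T.empRate Z {j} n ω) / T.empRate Z x n ω

/-- The loss model: the link indicators of all probes are independent, and link `e` passes each
probe with probability `α e`. -/
structure IsLossModel [MeasurableSpace Ω] (μ : Measure Ω) (α : T.Link → ℝ) : Prop where
  measurable : ∀ i e, Measurable (Z i e)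
  indep : iIndepFun (fun p : ℕ × T.Link => Z p.1 p.2) μ
  prob : ∀ i e, μ.real {ω | Z i e ω = true} = α e

end Estimator

/-- The admissible link pass rates. -/
def passRates : Set (T.Link → ℝ) := {α | ∀ e, 0 < α e ∧ α e ≤ 1}

end MulticastTree

/-! A probe is observed by every member of a nonempty `y ⊆ d_k` iff it reaches `k` and, for each `j
∈ y`, some receiver below is connected to `k` through `j`. These events depend on disjoint sets of
links, so the probability is `c y = A * ∏ j ∈ y, β j` (`jointRate_eq`), and `(∏ c {j}) / c x = A ^
(#x - 1)`: the subtree rates `β j` cancel.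

The estimator is this same ratio evaluated at the empirical frequencies, which are means of i.i.d.
indicator vectors, so the delta method gives Gaussian limits. A product of two joint-observation
indicators is the indicator of the union, so the variance of the linearized logarithm is a finite
sum of ratios of the `c y`. It equals `logVariance / A` (`variance_logRatioDeriv`), where, with `m =
#x`, `logVariance = m(m-1) - (m-1)²A - ∑ 1/β j + 1/∏ β j`.

Near `α = 1` the first-order parts of `∑ 1/β j` and `1/∏ β j` cancel, leaving `(m-1)²(1 - A)`, that
is `(m-1)² s` up to second order (`logVariance_sub_isBigO`). Parts (a) and (b) apply a root and the
identity to the estimator; this multiplies `logVariance` by a power of `A`, and in (a) also by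
`1/(m-1)²`. The powers of `A` matter only to second order. -/

namespace MulticastTree

/-! ### Paths in the tree as a partial order. -/

section Order

variable {V : Type*} {T : MulticastTree V} {u v w k i j : V}

theorem OnPath.refl (T : MulticastTree V) (u : V) : T.OnPath u u := ⟨0, rfl⟩

theorem OnPath.trans (huv : T.OnPath u v) (hvw : T.OnPath v w) : T.OnPath u w := by
  obtain ⟨a, rfl⟩ := huv
  obtain ⟨b, rfl⟩ := hvw
  exact ⟨a + b, Function.iterate_add_apply _ _ _ _⟩

theorem OnPath.total (hu : T.OnPath u v) (hw : T.OnPath w v) : T.OnPath u w ∨ T.OnPath w u := by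
  obtain ⟨a, rfl⟩ := hu
  obtain ⟨b, rfl⟩ := hw
  rcases le_total a b with h | h
  · obtain ⟨c, rfl⟩ := Nat.exists_eq_add_of_le' h
    exact Or.inr ⟨c, (Function.iterate_add_apply _ _ _ _).symm⟩
  · obtain ⟨c, rfl⟩ := Nat.exists_eq_add_of_le' h
    exact Or.inl ⟨c, (Function.iterate_add_apply _ _ _ _).symm⟩

theorem iterate_parent_root (T : MulticastTree V) (n : ℕ) : T.parent^[n] T.root = T.root :=
  Function.iterate_fixed T.parent_root n

/-- Running round a cycle `l` times takes at least `l` steps, hence passes the root, which is never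
left again. -/
theorem eq_root_of_iterate_parent_eq {p : ℕ} (hp : 0 < p) (h : T.parent^[p] u = u) :
    u = T.root := by
  obtain ⟨l, hl⟩ := T.exists_iterate_eq_root u
  have h1 : T.parent^[p * l] u = u := by
    rw [Function.iterate_mul]
    exact Function.iterate_fixed h l
  have h2 : l ≤ p * l := Nat.le_mul_of_pos_left l hp
  obtain ⟨c, hc⟩ := Nat.exists_eq_add_of_le' h2
  rw [hc, Function.iterate_add_apply, hl, iterate_parent_root] at h1
  exact h1.symm

theorem OnPath.antisymm (huv : T.OnPath u v) (hvu : T.OnPath v u) : u = v := by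
  obtain ⟨a, rfl⟩ := huv
  obtain ⟨b, hb⟩ := hvu
  rcases Nat.eq_zero_or_pos (b + a) with h | h
  · obtain rfl : a = 0 := by lia
    rfl
  · rw [← Function.iterate_add_apply] at hb
    rw [eq_root_of_iterate_parent_eq h hb, iterate_parent_root]

theorem IsChild.onPath (h : T.IsChild j k) : T.OnPath k j := ⟨1, h.2⟩

theorem IsChild.not_onPath (h : T.IsChild j k) : ¬ T.OnPath j k := by
  rintro ⟨l, hl⟩
  refine h.1 (eq_root_of_iterate_parent_eq (Nat.succ_pos l) ?_)
  rw [Function.iterate_succ_apply, h.2, hl]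

/-- A node on the path to a child is the child itself or lies on the path to its parent. -/
theorem IsChild.eq_or_onPath (h : T.IsChild j k) (hu : T.OnPath u j) : u = j ∨ T.OnPath u k := by
  obtain ⟨_ | l, rfl⟩ := hu
  · exact Or.inl rfl
  · refine Or.inr ⟨l, ?_⟩
    rw [Function.iterate_succ_apply, h.2]

theorem IsChild.eq_of_onPath (hi : T.IsChild i k) (hj : T.IsChild j k) (hiu : T.OnPath i u)
    (hju : T.OnPath j u) : i = j := by
  rcases hiu.total hju with h | h
  · exact (hj.eq_or_onPath h).resolve_right hi.not_onPath
  · exact ((hi.eq_or_onPath h).resolve_right hj.not_onPath).symm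

/-- By finiteness, some node below `j` has no strict descendant; it is a leaf. -/
theorem exists_isLeaf_onPath [Finite V] (T : MulticastTree V) (j : V) :
    ∃ r, T.IsLeaf r ∧ T.OnPath j r := by
  have : IsTrans V fun a b => T.OnPath b a ∧ a ≠ b := by
    refine ⟨fun a b c hab hbc => ⟨hbc.1.trans hab.1, ?_⟩⟩
    rintro rfl
    exact hab.2 (hbc.1.antisymm hab.1)
  have : Std.Irrefl fun a b => T.OnPath b a ∧ a ≠ b := ⟨fun a h => h.2 rfl⟩
  obtain ⟨r, hr, hmin⟩ := (Finite.wellFounded_of_trans_of_irrefl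
    fun a b => T.OnPath b a ∧ a ≠ b).has_min {r | T.OnPath j r} ⟨j, OnPath.refl T j⟩
  refine ⟨r, fun c hc => hmin c (hr.trans hc.onPath) ⟨hc.onPath, ?_⟩, hr⟩
  rintro rfl
  exact hc.not_onPath (OnPath.refl T c)

end Order

/-! ### Splitting observation into reaching `k` and being observed below it. -/

section Observation

variable {V : Type*} {T : MulticastTree V} {k j : V} {z : T.Link → Bool}

/-- Some receiver in the subtree hanging from the link into `j` is connected to the parent of `j`,
that is, all links from `j` on towards it pass. -/
def ObservedBelow (T : MulticastTree V) (z : T.Link → Bool) (j : V) : Prop :=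
  ∃ r, T.IsLeaf r ∧ T.OnPath j r ∧ ∀ e : T.Link, T.OnPath j e.1 → T.OnPath e.1 r → z e = true

theorem observed_iff (h : T.IsChild j k) :
    T.Observed z j ↔ T.Reaches z k ∧ T.ObservedBelow z j := by
  constructor
  · rintro ⟨r, hr, hjr, hz⟩
    exact ⟨fun e he => hz e (he.trans (h.onPath.trans hjr)), r, hr, hjr, fun e _ he => hz e he⟩
  · rintro ⟨hk, r, hr, hjr, hz⟩
    refine ⟨r, hr, hjr, fun e he => ?_⟩
    rcases hjr.total he with h1 | h1
    · exact hz e h1 he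
    · rcases h.eq_or_onPath h1 with h2 | h2
      · exact hz e (h2 ▸ OnPath.refl T _) he
      · exact hk e h2

/-- Nonemptiness matters: for empty `y` the left side is vacuous, while the right side still
requires reaching `k`. -/
theorem forall_observed_iff {y : Finset V} (hy : ∀ j ∈ y, T.IsChild j k) (hne : y.Nonempty) :
    (∀ j ∈ y, T.Observed z j) ↔ T.Reaches z k ∧ ∀ j ∈ y, T.ObservedBelow z j := by
  obtain ⟨j₀, hj₀⟩ := hne
  constructor
  · exact fun h => ⟨((observed_iff (hy j₀ hj₀)).1 (h j₀ hj₀)).1,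
      fun j hj => ((observed_iff (hy j hj)).1 (h j hj)).2⟩
  · exact fun h j hj => (observed_iff (hy j hj)).2 ⟨h.1, h.2 j hj⟩

theorem observedBelow_of_forall [Finite V] (h : ∀ e, z e = true) : T.ObservedBelow z j := by
  obtain ⟨r, hr, hjr⟩ := T.exists_isLeaf_onPath j
  exact ⟨r, hr, hjr, fun e _ _ => h e⟩

end Observation

/-! ### The links on which each event depends, and their disjointness. -/

section Supports

variable {V : Type*} {T : MulticastTree V} {i j k : V} [Fintype V]

theorem mem_children : j ∈ T.children k ↔ T.IsChild j k := by
  simp [children]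

theorem mem_pathLinks {e : T.Link} : e ∈ T.pathLinks k ↔ T.OnPath e.1 k := by
  simp [pathLinks]

open Classical in
/-- The links of the subtree hanging from the link into `j`, that link included. -/
noncomputable def subtreeLinks (T : MulticastTree V) (j : V) : Finset T.Link :=
  Finset.univ.filter fun e => T.OnPath j e.1

theorem mem_subtreeLinks {e : T.Link} : e ∈ T.subtreeLinks j ↔ T.OnPath j e.1 := by
  simp [subtreeLinks]

theorem dependsOn_reaches (T : MulticastTree V) (k : V) :
    DependsOn (fun z => T.Reaches z k) (T.pathLinks k : Set T.Link) := by
  intro z z' h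
  refine propext (forall₂_congr fun e he => ?_)
  rw [h e (Finset.mem_coe.2 (mem_pathLinks.2 he))]

theorem dependsOn_observedBelow (T : MulticastTree V) (j : V) :
    DependsOn (fun z => T.ObservedBelow z j) (T.subtreeLinks j : Set T.Link) := by
  intro z z' h
  refine propext (exists_congr fun r => and_congr_right fun _ => and_congr_right fun _ =>
    forall₂_congr fun e he => ?_)
  rw [h e (Finset.mem_coe.2 (mem_subtreeLinks.2 he))]

theorem disjoint_pathLinks_subtreeLinks (hj : T.IsChild j k) :
    Disjoint (T.pathLinks k) (T.subtreeLinks j) :=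
  Finset.disjoint_left.2 fun _ h h' =>
    hj.not_onPath ((mem_subtreeLinks.1 h').trans (mem_pathLinks.1 h))

theorem disjoint_subtreeLinks (hi : T.IsChild i k) (hj : T.IsChild j k) (hij : i ≠ j) :
    Disjoint (T.subtreeLinks i) (T.subtreeLinks j) :=
  Finset.disjoint_left.2 fun _ h h' =>
    hij (hi.eq_of_onPath hj (mem_subtreeLinks.1 h) (mem_subtreeLinks.1 h'))

end Supports

end MulticastTree

/-! ### Independence of events determined by disjoint sets of coordinates. -/

section BlockIndependence

variable {ι : Type*} [Fintype ι] {μ : Measure (ι → Bool)} {A B : Set (ι → Bool)}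

theorem measureReal_inter_of_dependsOn
    (hμ : iIndepFun (fun i (z : ι → Bool) => z i) μ) {S T : Finset ι} (hST : Disjoint S T)
    (hA : DependsOn (fun z => z ∈ A) (S : Set ι)) (hB : DependsOn (fun z => z ∈ B) (T : Set ι)) :
    μ.real (A ∩ B) = μ.real A * μ.real B := by
  -- An event determined by the coordinates in `U` is the preimage of its own image under
  -- restriction to `U`, so independence of the restrictions applies to it.
  have hpre : ∀ {C : Set (ι → Bool)} {U : Finset ι}, DependsOn (fun z => z ∈ C) (U : Set ι) →
      (fun (z : ι → Bool) (i : U) => z i) ⁻¹' ((fun (z : ι → Bool) (i : U) => z i) '' C) = C := by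
    intro C U hC
    ext z
    constructor
    · rintro ⟨z', hz', h⟩
      have : (z' ∈ C) = (z ∈ C) := hC fun i hi => congrFun h ⟨i, hi⟩
      exact this ▸ hz'
    · exact fun hz => ⟨z, hz, rfl⟩
  have h := (hμ.indepFun_finset S T hST fun i => measurable_pi_apply i).measure_inter_preimage_eq_mul
    ((fun (z : ι → Bool) (i : S) => z i) '' A) ((fun (z : ι → Bool) (i : T) => z i) '' B)
    (Set.toFinite _).measurableSet (Set.toFinite _).measurableSet
  rw [hpre hA, hpre hB] at h
  simp [measureReal_def, h]

theorem measureReal_inter_iInter_of_dependsOn {κ : Type*}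
    (hμ : iIndepFun (fun i (z : ι → Bool) => z i) μ) {C : κ → Set (ι → Bool)} {S : Finset ι}
    {U : κ → Finset ι} (hA : DependsOn (fun z => z ∈ A) (S : Set ι)) (y : Finset κ)
    (hC : ∀ j ∈ y, DependsOn (fun z => z ∈ C j) (U j : Set ι))
    (hSU : ∀ j ∈ y, Disjoint S (U j)) (hU : (y : Set κ).Pairwise fun i j => Disjoint (U i) (U j)) :
    μ.real (A ∩ {z | ∀ j ∈ y, z ∈ C j}) = μ.real A * ∏ j ∈ y, μ.real (C j) := by
  classical
  induction y using Finset.induction with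
  | empty => simp
  | insert a y ha ih =>
    have hdep : DependsOn (fun z => z ∈ A ∩ {z | ∀ j ∈ y, z ∈ C j})
        ((S ∪ y.biUnion U : Finset ι) : Set ι) := by
      intro z z' h
      have h1 : (z ∈ A) = (z' ∈ A) := hA fun i hi => h i (by simp_all)
      have h2 : ∀ j ∈ y, (z ∈ C j) = (z' ∈ C j) := fun j hj =>
        hC j (Finset.mem_insert_of_mem hj) fun i hi => h i (by
          simp only [Finset.coe_union, Finset.coe_biUnion]
          exact Or.inr (Set.mem_biUnion hj hi))
      refine propext (and_congr (iff_of_eq h1) (forall₂_congr fun j hj => iff_of_eq (h2 j hj)))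
    have hdisj : Disjoint (S ∪ y.biUnion U) (U a) := by
      rw [Finset.disjoint_union_left, Finset.disjoint_biUnion_left]
      exact ⟨hSU a (Finset.mem_insert_self _ _), fun j hj =>
        hU (by simp [hj]) (by simp) (by rintro rfl; exact ha hj)⟩
    have hset : A ∩ {z | ∀ j ∈ insert a y, z ∈ C j} = (A ∩ {z | ∀ j ∈ y, z ∈ C j}) ∩ C a := by
      ext z
      simp only [Finset.forall_mem_insert, Set.mem_inter_iff, Set.mem_ofPred_eq]
      tauto
    rw [hset, measureReal_inter_of_dependsOn hμ hdisj hdep (hC a (Finset.mem_insert_self _ _)),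
      ih (fun j hj => hC j (Finset.mem_insert_of_mem hj))
        (fun j hj => hSU j (Finset.mem_insert_of_mem hj))
        (hU.mono (by simp)), Finset.prod_insert ha]
    ring

end BlockIndependence

/-- Passes from independent link indicators to independent probes: independence says that the joint
law is a product measure, and a product over pairs is a product of products. -/
theorem iIndepFun_curry {Ω ι κ 𝓧 : Type*} [MeasurableSpace Ω] [MeasurableSpace 𝓧] {μ : Measure Ω}
    {X : ι → κ → Ω → 𝓧} (mX : ∀ i j, Measurable (X i j))
    (h : iIndepFun (fun p : ι × κ => X p.1 p.2) μ) : iIndepFun (fun i ω j => X i j ω) μ := by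
  have := h.isProbabilityMeasure
  have h' : iIndepFun (fun p : (_ : ι) × κ => X p.1 p.2) μ :=
    h.precomp (Equiv.sigmaEquivProd ι κ).injective
  have hprob : ∀ i j, IsProbabilityMeasure (μ.map (X i j)) :=
    fun i j => Measure.isProbabilityMeasure_map (mX i j).aemeasurable
  have hi : ∀ i, μ.map (fun ω j => X i j ω) = Measure.infinitePi fun j => μ.map (X i j) := fun i =>
    (iIndepFun_iff_map_fun_eq_infinitePi_map (mX i)).1
      (h.precomp (g := fun j : κ => (i, j)) (Prod.mk_right_injective i))
  rw [iIndepFun_iff_map_fun_eq_infinitePi_map (by fun_prop)]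
  simp_rw [hi]
  have hX : μ.map (fun ω (p : (_ : ι) × κ) => X p.1 p.2 ω) =
      Measure.infinitePi fun p : (_ : ι) × κ => μ.map (X p.1 p.2) :=
    (iIndepFun_iff_map_fun_eq_infinitePi_map (fun p : (_ : ι) × κ => mX p.1 p.2)).1 h'
  rw [← Measure.infinitePi_map_piCurry (fun i j => μ.map (X i j)), ← hX,
    Measure.map_map (by fun_prop) (by fun_prop)]
  rfl

/-! ### Delta method for i.i.d. vectors. -/

section DeltaMethod

variable {Ω : Type*} [MeasurableSpace Ω] {μ : Measure Ω} [IsProbabilityMeasure μ]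

/-- Chebyshev's inequality for a sample mean. -/
theorem measureReal_le_abs_mean_sub_le {X : ℕ → Ω → ℝ} (hX : MemLp (X 0) 2 μ)
    (hindep : iIndepFun X μ) (hident : ∀ i, IdentDistrib (X i) (X 0) μ μ) {t : ℝ} (ht : 0 < t)
    {n : ℕ} (hn : n ≠ 0) :
    μ.real {ω | t ≤ |(∑ k ∈ Finset.range n, X k ω) / n - μ[X 0]|} ≤ Var[X 0; μ] / (n * t ^ 2) := by
  have hn' : (n : ℝ) ≠ 0 := by exact_mod_cast hn
  have hmem : ∀ i, MemLp (X i) 2 μ := fun i => (hident i).memLp_iff.2 hX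
  have hsum : MemLp (fun ω => ∑ k ∈ Finset.range n, X k ω) 2 μ :=
    memLp_finsetSum _ fun i _ => hmem i
  have hmean : μ[fun ω => (∑ k ∈ Finset.range n, X k ω) / n] = μ[X 0] := by
    rw [integral_div, integral_finsetSum _ fun i _ => (hmem i).integrable (by norm_num)]
    simp [(hident _).integral_eq, hn']
  have hvar : Var[fun ω => (∑ k ∈ Finset.range n, X k ω) / n; μ] = Var[X 0; μ] / n := by
    have h1 : Var[∑ k ∈ Finset.range n, X k; μ] = n * Var[X 0; μ] := by
      rw [IndepFun.variance_sum (fun i _ => hmem i) fun i _ j _ hij => hindep.indepFun hij]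
      simp [(hident _).variance_eq]
    have h2 : (fun ω => (∑ k ∈ Finset.range n, X k ω) / n) =
        fun ω => (n : ℝ)⁻¹ * (∑ k ∈ Finset.range n, X k) ω := by
      ext ω
      simp [div_eq_inv_mul]
    rw [h2, variance_const_mul, h1]
    field_simp
  have hch := meas_ge_le_variance_div_sq (μ := μ)
    (X := fun ω => (∑ k ∈ Finset.range n, X k ω) / n) (by
      simpa only [div_eq_inv_mul] using hsum.const_mul (n : ℝ)⁻¹) ht
  rw [hmean, hvar] at hch
  rw [measureReal_def]
  refine ENNReal.toReal_le_of_le_ofReal (by have := variance_nonneg (X 0) μ; positivity)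
    (hch.trans_eq ?_)
  rw [div_div]

variable {κ : Type*} [Fintype κ] {X : ℕ → Ω → κ → ℝ}

theorem measureReal_le_norm_mean_sub_le (hX : ∀ y, MemLp (fun ω => X 0 ω y) 2 μ)
    (hindep : iIndepFun X μ) (hident : ∀ i, IdentDistrib (X i) (X 0) μ μ) {t : ℝ} (ht : 0 < t)
    {n : ℕ} (hn : n ≠ 0) :
    μ.real {ω | t ≤ ‖(fun y => (∑ k ∈ Finset.range n, X k ω y) / n - ∫ ω, X 0 ω y ∂μ)‖} ≤
      (∑ y, Var[fun ω => X 0 ω y; μ]) / (n * t ^ 2) := by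
  have hsub : {ω | t ≤ ‖(fun y => (∑ k ∈ Finset.range n, X k ω y) / n - ∫ ω, X 0 ω y ∂μ)‖} ⊆
      ⋃ y ∈ (Finset.univ : Finset κ),
        {ω | t ≤ |(∑ k ∈ Finset.range n, X k ω y) / n - ∫ ω, X 0 ω y ∂μ|} := by
    intro ω hω
    by_contra h
    simp only [Finset.mem_univ, Set.iUnion_true, Set.mem_iUnion, Set.mem_ofPred_eq, not_exists,
      not_le] at h
    exact not_lt.2 (Set.mem_ofPred_eq ▸ hω) ((pi_norm_lt_iff ht).2 h)
  refine (measureReal_mono hsub (measure_ne_top _ _)).trans ((measureReal_biUnion_finset_le _ _).trans ?_)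
  rw [Finset.sum_div]
  refine Finset.sum_le_sum fun y _ => ?_
  exact measureReal_le_abs_mean_sub_le (X := fun k ω => X k ω y) (hX y)
    (hindep.comp (fun _ p => p y) fun _ => measurable_pi_apply y)
    (fun i => (hident i).comp (measurable_pi_apply y)) ht hn

/-- The delta method, for means of independent identically distributed random vectors. -/
theorem tendstoInDistribution_sqrt_mul_comp_mean_sub (hX : ∀ y, MemLp (fun ω => X 0 ω y) 2 μ)
    (hindep : iIndepFun X μ) (hident : ∀ i, IdentDistrib (X i) (X 0) μ μ)
    {g : (κ → ℝ) → ℝ} {g' : (κ → ℝ) →L[ℝ] ℝ} (hg : Measurable g)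
    (hg' : HasFDerivAt g g' fun y => ∫ ω, X 0 ω y ∂μ) :
    TendstoInDistribution
      (fun (n : ℕ) ω => √n * (g (fun y => (∑ k ∈ Finset.range n, X k ω y) / n)
        - g fun y => ∫ ω, X 0 ω y ∂μ))
      atTop id (fun _ => μ) (gaussianReal 0 Var[fun ω => g' (X 0 ω); μ].toNNReal) := by
  set c : κ → ℝ := fun y => ∫ ω, X 0 ω y ∂μ with hc
  obtain ⟨d, hd⟩ : ∃ d : κ → ℝ, ∀ p, g' p = ∑ y, p y * d y := by
    classical
    refine ⟨fun y => g' (Pi.single y 1), fun p => ?_⟩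
    conv_lhs => rw [← Finset.univ_sum_single p, map_sum]
    refine Finset.sum_congr rfl fun y _ => ?_
    rw [← smul_eq_mul, ← map_smul, ← Pi.single_smul', smul_eq_mul, mul_one]
  have hmemg : MemLp (fun ω => g' (X 0 ω)) 2 μ := by
    simp_rw [hd]
    exact memLp_finsetSum _ fun y _ => by simpa [mul_comm] using (hX y).const_mul (d y)
  have hmean : μ[fun ω => g' (X 0 ω)] = g' c := by
    simp_rw [hd]
    rw [integral_finsetSum _ fun y _ => ((hX y).integrable (by norm_num)).mul_const _]
    simp_rw [integral_mul_const]
    rfl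
  have hclt := tendstoInDistribution_inv_sqrt_mul_sum_sub (P := μ) (X := fun k ω => g' (X k ω))
    (Y := id) (P' := gaussianReal 0 Var[fun ω => g' (X 0 ω); μ].toNNReal)
    ⟨aemeasurable_id, Measure.map_id⟩ hmemg
    (hindep.comp (fun _ p => g' p) fun _ => g'.measurable)
    (fun i => (hident i).comp g'.measurable)
  rw [hmean] at hclt
  have hmX : ∀ i, AEMeasurable (X i) μ := fun i => (hident i).aemeasurable_fst
  have hmXy : ∀ i y, AEMeasurable (fun ω => X i ω y) μ := fun i y =>
    (measurable_pi_apply y).comp_aemeasurable (hmX i)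
  -- The central limit theorem handles the linear part `g'`; what remains is that `√n` times the
  -- linearization error tends to 0 in measure.
  refine tendstoInDistribution_of_tendstoInMeasure_sub _ _ hclt ?_ ?_
  · rw [tendstoInMeasure_iff_measureReal_norm]
    intro ε hε
    set K : ℝ := ∑ y, Var[fun ω => X 0 ω y; μ] with hK
    have hK0 : 0 ≤ K := Finset.sum_nonneg fun y _ => variance_nonneg _ _
    rw [Metric.tendsto_atTop]
    intro δ hδ
    -- `K * η ^ 2 / ε ^ 2` is Chebyshev's bound for a deviation of at least `ε / (η * √n)`, with `n`
    -- cancelled. The other bad event, a deviation of at least the radius `r` on which the error is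
    -- at most `η` times the deviation, has probability `O(1/n)`.
    obtain ⟨η, hη, hηδ⟩ : ∃ η > 0, K * η ^ 2 / ε ^ 2 < δ / 2 := by
      have : Tendsto (fun η : ℝ => K * η ^ 2 / ε ^ 2) (𝓝[>] 0) (𝓝 (K * 0 ^ 2 / ε ^ 2)) :=
        Tendsto.mono_left (Continuous.tendsto (by fun_prop) 0) nhdsWithin_le_nhds
      have h := (this.eventually_lt_const (u := δ / 2) (by simpa using half_pos hδ)).and
        self_mem_nhdsWithin
      obtain ⟨η, h1, h2⟩ := h.exists
      exact ⟨η, h2, h1⟩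
    obtain ⟨r, hr, hball⟩ := Metric.eventually_nhds_iff.1 (hg'.isLittleO.def hη)
    have hlim : Tendsto (fun n : ℕ => K / r ^ 2 / (n : ℝ)) atTop (𝓝 0) :=
      tendsto_const_div_atTop_nhds_zero_nat _
    obtain ⟨N, hN⟩ := eventually_atTop.1 (hlim.eventually_lt_const (half_pos hδ))
    refine ⟨max N 1, fun n hn => ?_⟩
    have hn0 : n ≠ 0 := by have := le_of_max_le_right hn; lia
    have hnpos : (0 : ℝ) < n := by positivity
    have hsq : (√n) ^ 2 = (n : ℝ) := Real.sq_sqrt hnpos.le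
    have hsqpos : 0 < √(n : ℝ) := Real.sqrt_pos.2 hnpos
    rw [Real.dist_eq, sub_zero, abs_of_nonneg measureReal_nonneg]
    set D : Ω → κ → ℝ := fun ω y => (∑ k ∈ Finset.range n, X k ω y) / n - c y with hD
    have hsub : {ω | ε ≤ ‖((fun (n : ℕ) ω => √n * (g (fun y => (∑ k ∈ Finset.range n, X k ω y) / n)
        - g c)) - fun (n : ℕ) ω => (√n)⁻¹ * (∑ k ∈ Finset.range n, g' (X k ω) - n * g' c)) n ω
          - (0 : ℕ → Ω → ℝ) n ω‖} ⊆ {ω | r ≤ ‖D ω‖} ∪ {ω | ε / (η * √n) ≤ ‖D ω‖} := by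
      intro ω hω
      by_contra h
      simp only [Set.mem_union, Set.mem_ofPred_eq, not_or, not_le] at h
      refine not_lt.2 (Set.mem_ofPred_eq ▸ hω) ?_
      set m : κ → ℝ := fun y => (∑ k ∈ Finset.range n, X k ω y) / n with hm
      have hDm : D ω = m - c := rfl
      have hgm : g' m = (n : ℝ)⁻¹ * ∑ k ∈ Finset.range n, g' (X k ω) := by
        have : m = (n : ℝ)⁻¹ • ∑ k ∈ Finset.range n, X k ω := by
          ext y
          simp [hm, div_eq_inv_mul]
        rw [this, map_smul, map_sum, smul_eq_mul]
      have hrem : ‖g m - g c - g' (m - c)‖ ≤ η * ‖m - c‖ := by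
        refine hball ?_
        rw [dist_eq_norm]
        exact h.1
      have heq : √n * (g m - g c) - (√n)⁻¹ * (∑ k ∈ Finset.range n, g' (X k ω) - n * g' c) =
          √n * (g m - g c - g' (m - c)) := by
        rw [map_sub, hgm]
        have h1 : (n : ℝ)⁻¹ = (√n)⁻¹ * (√n)⁻¹ := by rw [← mul_inv, ← sq, hsq]
        have h2 : (n : ℝ) = √n * √n := by rw [← sq, hsq]
        rw [h1]
        nth_rewrite 3 [h2]
        field_simp
      simp only [Pi.sub_apply, Pi.zero_apply, sub_zero]
      rw [heq, norm_mul, Real.norm_of_nonneg hsqpos.le]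
      calc √n * ‖g m - g c - g' (m - c)‖ ≤ √n * (η * ‖m - c‖) := by gcongr
        _ < √n * (η * (ε / (η * √n))) := by
          have := h.2
          rw [hDm] at this
          gcongr
        _ = ε := by field_simp
    refine (measureReal_mono hsub).trans_lt ((measureReal_union_le _ _).trans_lt ?_)
    have h1 := measureReal_le_norm_mean_sub_le hX hindep hident hr hn0
    have h2 := measureReal_le_norm_mean_sub_le hX hindep hident
      (t := ε / (η * √n)) (by positivity) hn0
    have h3 := hN n (le_of_max_le_left hn)
    have h4 : K / (n * r ^ 2) = K / r ^ 2 / n := by field_simp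
    have h5 : K / (n * (ε / (η * √n)) ^ 2) = K * η ^ 2 / ε ^ 2 := by
      rw [div_pow, mul_pow, hsq]
      field_simp
    rw [← hK, h4] at h1
    rw [← hK, h5] at h2
    linarith
  · intro n
    refine ((hg.comp_aemeasurable (aemeasurable_pi_lambda _ fun y => ?_)).sub_const _).const_mul _
    exact (Finset.aemeasurable_fun_sum _ fun k _ => hmXy k y).div_const _

end DeltaMethod

/-! ### Second-order expansions in a small parameter. -/

section Expansions

open Asymptotics

variable {α ι : Type*} {l : Filter α} {ε : α → ℝ}

theorem isBigO_prod_one_sub (hε : Tendsto ε l (𝓝 0)) {a : ι → α → ℝ} (s : Finset ι)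
    (ha : ∀ i ∈ s, a i =O[l] ε) :
    (fun t => ∏ i ∈ s, (1 - a i t) - 1 + ∑ i ∈ s, a i t) =O[l] fun t => ε t ^ 2 := by
  classical
  induction s using Finset.induction with
  | empty => simpa using isBigO_zero _ _
  | insert i s hi ih =>
    have h1 := ha i (Finset.mem_insert_self _ _)
    have h2 : (fun t => ∑ i ∈ s, a i t) =O[l] ε :=
      IsBigO.fun_sum fun j hj => ha j (Finset.mem_insert_of_mem hj)
    have h3 : (fun t => 1 - a i t) =O[l] fun _ => (1 : ℝ) :=
      (tendsto_const_nhds.sub (h1.trans_tendsto hε)).isBigO_one ℝ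
    have h4 := (h3.mul (ih fun j hj => ha j (Finset.mem_insert_of_mem hj))).add
      ((h1.mul h2).congr_right (g₂ := fun t => 1 * ε t ^ 2) fun t => by ring)
    refine h4.congr (fun t => ?_) fun t => one_mul _
    rw [Finset.prod_insert hi, Finset.sum_insert hi]
    ring

theorem isBigO_inv_one_sub (hε : Tendsto ε l (𝓝 0)) {u : α → ℝ} (hu : u =O[l] ε) :
    (fun t => (1 - u t)⁻¹ - 1 - u t) =O[l] fun t => ε t ^ 2 := by
  have hu0 : Tendsto (fun t => 1 - u t) l (𝓝 (1 - 0)) :=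
    tendsto_const_nhds.sub (hu.trans_tendsto hε)
  have hinv : (fun t => (1 - u t)⁻¹) =O[l] fun _ => (1 : ℝ) :=
    (hu0.inv₀ (by norm_num)).isBigO_one ℝ
  refine ((hu.pow 2).mul hinv).congr' ?_ (.of_forall fun t => mul_one _)
  filter_upwards [hu0.eventually_ne (by norm_num : (1 - 0 : ℝ) ≠ 0)] with t ht
  field_simp
  ring

theorem isBigO_pow_sub_one (hε : Tendsto ε l (𝓝 0)) {A : α → ℝ}
    (hA : (fun t => A t - 1) =O[l] ε) (n : ℕ) : (fun t => A t ^ n - 1) =O[l] ε := by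
  have hA1 : (fun t => A t) =O[l] fun _ => (1 : ℝ) := by
    have h := ((hA.trans_tendsto hε).add_const 1).isBigO_one ℝ
    simpa using h
  induction n with
  | zero => simpa using isBigO_zero _ _
  | succ n ih =>
    exact (((hA1.mul ih).congr_right fun t => one_mul _).add hA).congr_left fun t => by ring

theorem isBigO_self_of_sq {u s : α → ℝ} (hε : Tendsto ε l (𝓝 0))
    (hs : s =O[l] ε) (h : (fun t => u t - s t) =O[l] fun t => ε t ^ 2) : u =O[l] ε := by
  have h2 : (fun t => ε t ^ 2) =O[l] ε := by
    simpa [sq] using (hε.isBigO_one ℝ).mul (isBigO_refl ε l)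
  exact ((h.trans h2).add hs).congr_left fun t => by ring

/-- `A` times the asymptotic variance of the logarithm of the local estimator, where `A` is the pass
rate of the path to the node and `β j` the conditional probability of observation by `j` for a probe
that reaches the node. -/
noncomputable def logVariance (x : Finset ι) (A : ℝ) (β : ι → ℝ) : ℝ :=
  (x.card : ℝ) * (x.card - 1) - ((x.card : ℝ) - 1) ^ 2 * A - ∑ j ∈ x, (β j)⁻¹
    + (∏ j ∈ x, β j)⁻¹

/-- With `b j = 1 - β j`, both `∑ (1/β j - 1)` and `1/∏ β j - 1` are `∑ b j` up to second order and
enter with opposite signs, so only the path term survives. -/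
theorem logVariance_sub_isBigO (hε : Tendsto ε l (𝓝 0)) {A s : α → ℝ} {β : α → ι → ℝ}
    {x : Finset ι} (hA : (fun t => A t - 1 + s t) =O[l] fun t => ε t ^ 2)
    (hβ : ∀ j ∈ x, (fun t => 1 - β t j) =O[l] ε) :
    (fun t => logVariance x (A t) (β t) - ((x.card : ℝ) - 1) ^ 2 * s t)
      =O[l] fun t => ε t ^ 2 := by
  have h1 : ∀ j ∈ x, (fun t => (β t j)⁻¹ - 1 - (1 - β t j)) =O[l] fun t => ε t ^ 2 := fun j hj =>
    (isBigO_inv_one_sub hε (hβ j hj)).congr_left fun t => by simp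
  have h2 : (fun t => ∏ j ∈ x, β t j - 1 + ∑ j ∈ x, (1 - β t j)) =O[l] fun t => ε t ^ 2 :=
    (isBigO_prod_one_sub hε x hβ).congr_left fun t => by simp
  have h3 : (fun t => 1 - ∏ j ∈ x, β t j) =O[l] ε :=
    isBigO_self_of_sq hε (IsBigO.fun_sum hβ) (h2.neg_left.congr_left fun t => by ring)
  have h4 : (fun t => (∏ j ∈ x, β t j)⁻¹ - 1 - (1 - ∏ j ∈ x, β t j)) =O[l] fun t => ε t ^ 2 :=
    (isBigO_inv_one_sub hε h3).congr_left fun t => by simp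
  refine ((((hA.const_mul_left (-((x.card : ℝ) - 1) ^ 2)).sub (IsBigO.fun_sum h1)).add h4).sub
    h2).congr_left fun t => ?_
  simp only [logVariance, Finset.sum_sub_distrib, Finset.sum_const, nsmul_eq_mul]
  ring

/-- `(A ^ n - 1) * H` is a product of two first-order quantities. -/
theorem pow_mul_sub_isBigO (hε : Tendsto ε l (𝓝 0)) {A H s : α → ℝ} (hs : s =O[l] ε)
    (hA : (fun t => A t - 1) =O[l] ε) (hH : (fun t => H t - s t) =O[l] fun t => ε t ^ 2) (n : ℕ) :
    (fun t => A t ^ n * H t - s t) =O[l] fun t => ε t ^ 2 := by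
  have h1 := (isBigO_pow_sub_one hε hA n).mul (isBigO_self_of_sq hε hs hH)
  refine ((h1.congr_right (g₂ := fun t => ε t ^ 2) fun t => by ring).add hH).congr_left
    fun t => by ring

/-- Truncation at 0 is 1-Lipschitz and fixes `s ≥ 0`, so a variance may be stored as a nonnegative
real without spoiling its expansion. -/
theorem toNNReal_sub_isBigO {f s : α → ℝ} (hs : ∀ᶠ t in l, 0 ≤ s t)
    (h : (fun t => f t - s t) =O[l] fun t => ε t ^ 2) :
    (fun t => ((f t).toNNReal : ℝ) - s t) =O[l] fun t => ε t ^ 2 := by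
  refine IsBigO.trans (IsBigO.of_bound 1 ?_) h
  filter_upwards [hs] with t ht
  rw [Real.coe_toNNReal', one_mul, Real.norm_eq_abs, Real.norm_eq_abs]
  calc |max (f t) 0 - s t| = |max (f t) 0 - max (s t) 0| := by rw [max_eq_left ht]
    _ ≤ |f t - s t| := abs_max_sub_max_le_abs _ _ _

end Expansions

/-! ### Derivative of the ratio and variance of its linearized logarithm. -/

section LogRatio

variable {V : Type*}

/-- The derivative of the logarithm of `(∏ j ∈ x, p {j}) / p x` at `p = c`. -/
noncomputable def logRatioDeriv (x : Finset V) (c : Finset V → ℝ) : (Finset V → ℝ) →L[ℝ] ℝ :=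
  ∑ j ∈ x, (c {j})⁻¹ • ContinuousLinearMap.proj (R := ℝ) (φ := fun _ : Finset V => ℝ) {j}
    - (c x)⁻¹ • ContinuousLinearMap.proj (R := ℝ) (φ := fun _ : Finset V => ℝ) x

theorem logRatioDeriv_apply (x : Finset V) (c p : Finset V → ℝ) :
    logRatioDeriv x c p = ∑ j ∈ x, (c {j})⁻¹ * p {j} - (c x)⁻¹ * p x := by
  simp [logRatioDeriv]

theorem hasFDerivAt_prod_div [Fintype V] [DecidableEq V] {x : Finset V} {c : Finset V → ℝ}
    (hj : ∀ j ∈ x, c {j} ≠ 0) (hx : c x ≠ 0) :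
    HasFDerivAt (fun p : Finset V → ℝ => (∏ j ∈ x, p {j}) / p x)
      (((∏ j ∈ x, c {j}) / c x) • logRatioDeriv x c) c := by
  have hproj : ∀ y : Finset V, HasFDerivAt (fun p : Finset V → ℝ => p y)
      (ContinuousLinearMap.proj (R := ℝ) (φ := fun _ : Finset V => ℝ) y) c := fun y =>
    hasFDerivAt_apply y c
  have h1 := HasFDerivAt.finsetProd (u := x) (g := fun j (p : Finset V → ℝ) => p {j})
    fun j _ => hproj {j}
  have h2 := (hasDerivAt_inv hx).comp_hasFDerivAt c (hproj x)
  refine ((h1.mul h2).congr_fderiv ?_).congr_of_eventuallyEq ?_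
  · ext p
    simp only [add_apply, smul_apply, sum_apply, ContinuousLinearMap.proj_apply, smul_eq_mul,
      logRatioDeriv_apply, Function.comp_apply]
    have h3 : ∀ i ∈ x, (∏ j ∈ x.erase i, c {j}) * p {i} =
        (∏ j ∈ x, c {j}) * ((c {i})⁻¹ * p {i}) := fun i hi => by
      rw [← Finset.mul_prod_erase x (fun j => c {j}) hi]
      field_simp [hj i hi]
    rw [Finset.sum_congr rfl h3, ← Finset.mul_sum]
    field_simp
    ring
  · exact .of_forall fun p => by simp [div_eq_mul_inv]

/-- By `hmul` the square of the linear form is again linear in the indicators, so its mean involves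
only the values of `c`. -/
theorem variance_logRatioDeriv [DecidableEq V] {Ω : Type*} [MeasurableSpace Ω] {ν : Measure Ω}
    [IsProbabilityMeasure ν] {U : Ω → Finset V → ℝ} (hU : ∀ y, MemLp (fun z => U z y) 2 ν)
    (hmul : ∀ z a b, U z a * U z b = U z (a ∪ b)) {x : Finset V} {A : ℝ} {β : V → ℝ} (hA : A ≠ 0)
    (hβ : ∀ j ∈ x, β j ≠ 0) {c : Finset V → ℝ} (hc : ∀ y, c y = ∫ z, U z y ∂ν)
    (hcy : ∀ y ⊆ x, y.Nonempty → c y = A * ∏ j ∈ y, β j) (hx : x.Nonempty) :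
    Var[fun z => logRatioDeriv x c (U z); ν] = logVariance x A β / A := by
  have hint : ∀ y, Integrable (fun z => U z y) ν := fun y => (hU y).integrable (by norm_num)
  have hj : ∀ j ∈ x, c {j} = A * β j := fun j hj => by
    rw [hcy {j} (by simpa using hj) (by simp), Finset.prod_singleton]
  have hjne : ∀ j ∈ x, c {j} ≠ 0 := fun j h => by
    rw [hj j h]
    exact mul_ne_zero hA (hβ j h)
  have hcx := hcy x subset_rfl hx
  have hcxne : c x ≠ 0 := by
    rw [hcx]
    exact mul_ne_zero hA (Finset.prod_ne_zero_iff.2 hβ)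
  have hmem : MemLp (fun z => logRatioDeriv x c (U z)) 2 ν := by
    simp_rw [logRatioDeriv_apply]
    exact (memLp_finsetSum _ fun j _ => (hU {j}).const_mul _).sub ((hU x).const_mul _)
  have hmean : ∫ z, logRatioDeriv x c (U z) ∂ν = x.card - 1 := by
    simp_rw [logRatioDeriv_apply]
    rw [integral_sub (integrable_finsetSum _ fun j _ => (hint {j}).const_mul _)
      ((hint x).const_mul _), integral_finsetSum _ fun j _ => (hint {j}).const_mul _]
    simp_rw [integral_const_mul, ← hc]
    rw [inv_mul_cancel₀ hcxne, Finset.sum_congr rfl fun j h => inv_mul_cancel₀ (hjne j h)]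
    simp
  have hsq : ∀ z, logRatioDeriv x c (U z) ^ 2 =
      ∑ i ∈ x, ∑ j ∈ x, (c {i})⁻¹ * (c {j})⁻¹ * U z ({i} ∪ {j})
        - ∑ j ∈ x, 2 * (c x)⁻¹ * (c {j})⁻¹ * U z x + (c x)⁻¹ ^ 2 * U z x := fun z => by
    have h1 : (∑ i ∈ x, (c {i})⁻¹ * U z {i}) ^ 2 =
        ∑ i ∈ x, ∑ j ∈ x, (c {i})⁻¹ * (c {j})⁻¹ * U z ({i} ∪ {j}) := by
      rw [sq, Finset.sum_mul_sum]
      refine Finset.sum_congr rfl fun i _ => Finset.sum_congr rfl fun j _ => ?_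
      rw [← hmul]
      ring
    have h2 : (∑ j ∈ x, (c {j})⁻¹ * U z {j}) * U z x = ∑ j ∈ x, (c {j})⁻¹ * U z x := by
      rw [Finset.sum_mul]
      refine Finset.sum_congr rfl fun j h => ?_
      rw [mul_assoc, hmul, Finset.singleton_union, Finset.insert_eq_of_mem h]
    have h3 : U z x * U z x = U z x := by rw [hmul, Finset.union_self]
    simp_rw [mul_assoc (2 * (c x)⁻¹)]
    rw [logRatioDeriv_apply, ← h1, ← Finset.mul_sum, ← h2]
    linear_combination (c x)⁻¹ ^ 2 * h3
  have hsqint : ∫ z, logRatioDeriv x c (U z) ^ 2 ∂ν =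
      ∑ i ∈ x, ∑ j ∈ x, (c {i})⁻¹ * (c {j})⁻¹ * c ({i} ∪ {j})
        - ∑ j ∈ x, 2 * (c x)⁻¹ * (c {j})⁻¹ * c x + (c x)⁻¹ ^ 2 * c x := by
    simp_rw [hsq]
    have i1 : ∀ i ∈ x, Integrable
        (fun z => ∑ j ∈ x, (c {i})⁻¹ * (c {j})⁻¹ * U z ({i} ∪ {j})) ν := fun i _ =>
      integrable_finsetSum _ fun j _ => (hint _).const_mul _
    have i2 : Integrable (fun z => ∑ j ∈ x, 2 * (c x)⁻¹ * (c {j})⁻¹ * U z x) ν :=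
      integrable_finsetSum _ fun j _ => (hint _).const_mul _
    have i3 : Integrable (fun z => ∑ i ∈ x, ∑ j ∈ x, (c {i})⁻¹ * (c {j})⁻¹ * U z ({i} ∪ {j})
        - ∑ j ∈ x, 2 * (c x)⁻¹ * (c {j})⁻¹ * U z x) ν := (integrable_finsetSum _ i1).sub i2
    rw [integral_add i3 ((hint x).const_mul _),
      integral_sub (integrable_finsetSum _ i1) i2, integral_finsetSum _ i1,
      integral_finsetSum _ fun j _ => (hint _).const_mul _, integral_const_mul, ← hc]
    simp_rw [integral_const_mul, ← hc]
    congr 2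
    refine Finset.sum_congr rfl fun i _ => ?_
    rw [integral_finsetSum _ fun j _ => (hint _).const_mul _]
    simp_rw [integral_const_mul, ← hc]
  -- Off the diagonal, `c {i, j} / (c {i} * c {j}) = 1/A`; on it the union collapses to `{i}`,
  -- leaving `1 / c {i} = 1/(A * β i)`.
  have hpair : ∀ i ∈ x, ∑ j ∈ x, (c {i})⁻¹ * (c {j})⁻¹ * c ({i} ∪ {j}) =
      (x.card - 1) * A⁻¹ + A⁻¹ * (β i)⁻¹ := fun i hi => by
    have hne : ∀ j ∈ x.erase i, (c {i})⁻¹ * (c {j})⁻¹ * c ({i} ∪ {j}) = A⁻¹ := fun j h => by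
      obtain ⟨hji, hjx⟩ := Finset.mem_erase.1 h
      have hβi := hβ i hi
      have hβj := hβ j hjx
      rw [hcy ({i} ∪ {j}) (by simp [Finset.insert_subset_iff, hi, hjx]) (by simp),
        hj i hi, hj j hjx, Finset.singleton_union, Finset.prod_pair hji.symm]
      field_simp
    rw [← Finset.add_sum_erase x _ hi, Finset.sum_congr rfl hne, Finset.union_self,
      inv_mul_cancel_right₀ (hjne i hi), hj i hi, Finset.sum_const, Finset.card_erase_of_mem hi,
      nsmul_eq_mul, Nat.cast_sub (Finset.card_pos.2 hx), mul_inv]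
    push_cast
    ring
  have hmid : ∀ j ∈ x, 2 * (c x)⁻¹ * (c {j})⁻¹ * c x = 2 * A⁻¹ * (β j)⁻¹ := fun j h => by
    rw [hj j h, mul_inv]
    field_simp
  rw [variance_eq_sub hmem]
  simp only [Pi.pow_apply]
  rw [hmean, hsqint, Finset.sum_congr rfl hpair, Finset.sum_congr rfl hmid,
    Finset.sum_add_distrib, Finset.sum_const, nsmul_eq_mul, ← Finset.mul_sum, ← Finset.mul_sum,
    sq (c x)⁻¹, inv_mul_cancel_right₀ hcxne, hcx, mul_inv, logVariance]
  field_simp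
  ring

end LogRatio

/-! ### The law of one probe and its observation rates. -/

namespace MulticastTree

section Rates

variable {V : Type*} [Fintype V] {T : MulticastTree V} {α : T.Link → ℝ}

theorem pathPassRate_pos (hα : α ∈ T.passRates) (k : V) : 0 < T.pathPassRate α k :=
  Finset.prod_pos fun e _ => (hα e).1

theorem eventually_pathLossSum_nonneg (T : MulticastTree V) (k : V) :
    ∀ᶠ α in 𝓝[T.passRates] (1 : T.Link → ℝ), 0 ≤ T.pathLossSum α k := by
  filter_upwards [self_mem_nhdsWithin] with α hα
  exact Finset.sum_nonneg fun e _ => sub_nonneg.2 (hα e).2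

end Rates

variable {V : Type*} [Fintype V] [DecidableEq V] {T : MulticastTree V} {k : V} {x : Finset V}
  {α : T.Link → ℝ}

/-- The law of the link indicators of one probe. -/
noncomputable def linkLaw (T : MulticastTree V) (α : T.Link → ℝ) : Measure (T.Link → Bool) :=
  Measure.pi fun e => bernoulliMeasure true false (Set.projIcc 0 1 zero_le_one (α e))

instance (α : T.Link → ℝ) : IsProbabilityMeasure (T.linkLaw α) := by
  unfold linkLaw
  infer_instance

theorem iIndepFun_linkLaw (α : T.Link → ℝ) :
    iIndepFun (fun e (z : T.Link → Bool) => z e) (T.linkLaw α) :=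
  iIndepFun_pi fun _ => aemeasurable_id

theorem linkLaw_real_eval_eq (α : T.Link → ℝ) (e : T.Link) (b : Bool) :
    (T.linkLaw α).real {z | z e = b} =
      (bernoulliMeasure true false (Set.projIcc 0 1 zero_le_one (α e))).real {b} :=
  (measurePreserving_eval (fun e => bernoulliMeasure true false
    (Set.projIcc 0 1 zero_le_one (α e))) e).measureReal_preimage
    (s := {b}) (MeasurableSet.singleton b).nullMeasurableSet

theorem linkLaw_real_eval (hα : α ∈ T.passRates) (e : T.Link) (b : Bool) :
    (T.linkLaw α).real {z | z e = b} = if b then α e else 1 - α e := by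
  rw [linkLaw_real_eval_eq, Set.projIcc_of_mem zero_le_one ⟨(hα e).1.le, (hα e).2⟩]
  cases b
  · rw [bernoulliMeasure_real_apply_of_notMem_of_mem _ (by measurability) (by simp) (by simp)]
    simp
  · rw [bernoulliMeasure_real_apply_of_mem_of_notMem _ (by measurability) (by simp) (by simp)]
    simp

theorem linkLaw_real_forall_mem (hα : α ∈ T.passRates) (s : Finset T.Link) :
    (T.linkLaw α).real {z | ∀ e ∈ s, z e = true} = ∏ e ∈ s, α e := by
  -- The block lemma with trivial first event and one-link blocks.
  have h := measureReal_inter_iInter_of_dependsOn (iIndepFun_linkLaw α) (A := Set.univ) (S := ∅)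
    (C := fun e => {z | z e = true}) (U := fun e => {e}) (fun _ _ _ => rfl) s
    (fun e _ z z' h => by
      have := h e (by simp)
      simp [this]) (fun _ _ => Finset.disjoint_empty_left _)
    (fun i _ j _ hij => Finset.disjoint_singleton.2 hij)
  simpa [linkLaw_real_eval hα] using h

theorem linkLaw_real_reaches (hα : α ∈ T.passRates) (k : V) :
    (T.linkLaw α).real {z | T.Reaches z k} = T.pathPassRate α k := by
  rw [pathPassRate, ← linkLaw_real_forall_mem hα]
  simp [Reaches, mem_pathLinks]

/-- The conditional probability that a probe is observed by `j`, if it reaches the parent of `j`. -/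
noncomputable def subtreeRate (T : MulticastTree V) (α : T.Link → ℝ) (j : V) : ℝ :=
  (T.linkLaw α).real {z | T.ObservedBelow z j}

/-- The probability that a probe is observed by all members of `y`. -/
noncomputable def jointRate (T : MulticastTree V) (α : T.Link → ℝ) (y : Finset V) : ℝ :=
  (T.linkLaw α).real {z | ∀ j ∈ y, T.Observed z j}

theorem jointRate_eq (hα : α ∈ T.passRates) {y : Finset V} (hy : y ⊆ T.children k)
    (hne : y.Nonempty) :
    T.jointRate α y = T.pathPassRate α k * ∏ j ∈ y, T.subtreeRate α j := by
  have hch : ∀ j ∈ y, T.IsChild j k := fun j hj => mem_children.1 (hy hj)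
  have h := measureReal_inter_iInter_of_dependsOn (iIndepFun_linkLaw α)
    (A := {z | T.Reaches z k}) (C := fun j => {z | T.ObservedBelow z j}) (U := T.subtreeLinks)
    (T.dependsOn_reaches k) y (fun j _ => T.dependsOn_observedBelow j)
    (fun j hj => disjoint_pathLinks_subtreeLinks (hch j hj))
    fun i hi j hj hij => disjoint_subtreeLinks (hch i hi) (hch j hj) hij
  rw [linkLaw_real_reaches hα] at h
  rw [jointRate, show {z | ∀ j ∈ y, T.Observed z j} = _ from
    Set.ext fun z => forall_observed_iff hch hne]
  exact h

/-- The event that all links pass has positive probability and forces observation; hence no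
denominator in the limit vanishes. -/
theorem subtreeRate_pos (hα : α ∈ T.passRates) (j : V) : 0 < T.subtreeRate α j := by
  have h1 : 0 < ∏ e, α e := Finset.prod_pos fun e _ => (hα e).1
  rw [← linkLaw_real_forall_mem hα] at h1
  exact h1.trans_le (measureReal_mono fun z hz =>
    observedBelow_of_forall fun e => hz e (Finset.mem_univ e))

/-- Union bound: a failed observation needs some link to fail. -/
theorem abs_one_sub_subtreeRate_le (hα : α ∈ T.passRates) (j : V) :
    |1 - T.subtreeRate α j| ≤ ∑ e, (1 - α e) := by
  have h0 : T.subtreeRate α j ≤ 1 := measureReal_le_one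
  rw [abs_of_nonneg (by linarith), subtreeRate,
    ← probReal_compl_eq_one_sub (Set.toFinite _).measurableSet]
  have hsub : {z | T.ObservedBelow z j}ᶜ ⊆
      ⋃ e ∈ (Finset.univ : Finset T.Link), {z | z e = false} := by
    intro z hz
    by_contra h
    refine hz (observedBelow_of_forall fun e => ?_)
    simp only [Finset.mem_univ, Set.iUnion_true, Set.mem_iUnion, Set.mem_ofPred_eq, not_exists,
      Bool.not_eq_false] at h
    exact h e
  refine (measureReal_mono hsub (measure_ne_top _ _)).trans
    ((measureReal_biUnion_finset_le _ _).trans_eq ?_)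
  simp [linkLaw_real_eval hα]

section Observations

open Classical in
/-- The indicators of the joint observations of one probe. -/
noncomputable def obsVec (T : MulticastTree V) (z : T.Link → Bool) (y : Finset V) : ℝ :=
  if ∀ j ∈ y, T.Observed z j then 1 else 0

theorem obsVec_mul (z : T.Link → Bool) (a b : Finset V) :
    T.obsVec z a * T.obsVec z b = T.obsVec z (a ∪ b) := by
  have h : (∀ j ∈ a ∪ b, T.Observed z j) ↔ (∀ j ∈ a, T.Observed z j) ∧ ∀ j ∈ b, T.Observed z j := by
    simp only [Finset.mem_union, or_imp, forall_and]
  unfold obsVec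
  by_cases ha : ∀ j ∈ a, T.Observed z j
  · by_cases hb : ∀ j ∈ b, T.Observed z j
    · rw [if_pos ha, if_pos hb, if_pos (h.2 ⟨ha, hb⟩), mul_one]
    · rw [if_neg hb, if_neg fun hab => hb (h.1 hab).2, mul_zero]
  · rw [if_neg ha, if_neg fun hab => ha (h.1 hab).1, zero_mul]

theorem integral_obsVec (α : T.Link → ℝ) (y : Finset V) :
    ∫ z, T.obsVec z y ∂T.linkLaw α = T.jointRate α y := by
  rw [jointRate, ← integral_indicator_one (Set.toFinite _).measurableSet]
  congr with z
  by_cases h : z ∈ {z | ∀ j ∈ y, T.Observed z j}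
  · rw [obsVec, if_pos (by exact h), Set.indicator_of_mem h]
    rfl
  · rw [obsVec, if_neg (by exact h), Set.indicator_of_notMem h]

theorem memLp_obsVec (α : T.Link → ℝ) (y : Finset V) :
    MemLp (fun z => T.obsVec z y) 2 (T.linkLaw α) := by
  refine MemLp.of_bound (Measurable.of_discrete).aestronglyMeasurable 1 (.of_forall fun z => ?_)
  unfold obsVec
  split_ifs <;> simp

theorem empRate_eq {Ω : Type*} (Z : ℕ → T.Link → Ω → Bool) (y : Finset V) (n : ℕ) (ω : Ω) :
    T.empRate Z y n ω = (∑ i ∈ Finset.range n, T.obsVec (fun e => Z i e ω) y) / n := by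
  simp only [empRate, coObs, obsVec, Finset.sum_boole]
  congr!

theorem localEstimator_eq {Ω : Type*} (Z : ℕ → T.Link → Ω → Bool) (x : Finset V) (n : ℕ) (ω : Ω) (h : ℝ → ℝ) :
    h (T.localEstimator Z x n ω) = (fun p : Finset V → ℝ => h ((∏ j ∈ x, p {j}) / p x))
      fun y => (∑ i ∈ Finset.range n, T.obsVec (fun e => Z i e ω) y) / n := by
  simp only [localEstimator, empRate_eq]

end Observations

/-! ### Central limit theorem for functions of the local estimator. -/

section Limit

variable {Ω : Type*} [MeasurableSpace Ω] {μ : Measure Ω} [IsProbabilityMeasure μ]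
  {Z : ℕ → T.Link → Ω → Bool}

theorem IsLossModel.map_eq (h : T.IsLossModel Z μ α) (hα : α ∈ T.passRates) (i : ℕ) :
    μ.map (fun ω e => Z i e ω) = T.linkLaw α := by
  have hind : iIndepFun (fun e => Z i e) μ :=
    h.indep.precomp (g := fun e : T.Link => (i, e)) (Prod.mk_right_injective i)
  rw [hind.map_fun_eq_pi_map fun e => (h.measurable i e).aemeasurable, linkLaw]
  congr
  ext1 e
  have hp := Measure.isProbabilityMeasure_map (μ := μ) (h.measurable i e).aemeasurable
  have ht : (μ.map (Z i e)).real {true} = α e := by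
    rw [map_measureReal_apply (h.measurable i e) (by measurability), ← h.prob i e]
    rfl
  have hf : (μ.map (Z i e)).real {false} = 1 - α e := by
    rw [← ht, ← probReal_compl_eq_one_sub (by measurability)]
    congr 1
    ext b
    simp
  have hb : ∀ b, (bernoulliMeasure true false (Set.projIcc 0 1 zero_le_one (α e))).real {b} =
      if b then α e else 1 - α e := fun b => by
    rw [← linkLaw_real_eval hα e b, linkLaw_real_eval_eq]
  refine Measure.ext_of_singleton fun b => ?_
  rw [← measureReal_eq_measureReal_iff, hb]
  cases b <;> simp [ht, hf]

theorem prod_jointRate_div (hα : α ∈ T.passRates) (hx : x ⊆ T.children k) (hne : x.Nonempty) :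
    (∏ j ∈ x, T.jointRate α {j}) / T.jointRate α x = T.pathPassRate α k ^ (x.card - 1) := by
  have hA := (pathPassRate_pos hα k).ne'
  have hβ : ∏ j ∈ x, T.subtreeRate α j ≠ 0 :=
    Finset.prod_ne_zero_iff.2 fun j _ => (subtreeRate_pos hα j).ne'
  have h1 : ∀ j ∈ x, T.jointRate α {j} = T.pathPassRate α k * T.subtreeRate α j := fun j hj => by
    rw [jointRate_eq hα (by simpa using hx hj) (by simp), Finset.prod_singleton]
  rw [Finset.prod_congr rfl h1, jointRate_eq hα hx hne, Finset.prod_mul_distrib,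
    Finset.prod_const, mul_div_mul_right _ _ hβ, div_eq_iff hA, ← pow_succ,
    Nat.sub_add_cancel (Finset.card_pos.2 hne)]

/-- Stated for a general `h` so as to serve both parts: the root in (a), the identity in (b). -/
theorem IsLossModel.tendstoInDistribution_comp_localEstimator (hZ : T.IsLossModel Z μ α)
    (hα : α ∈ T.passRates) (hx : x ⊆ T.children k) (hne : x.Nonempty) {h : ℝ → ℝ} {h' : ℝ}
    (hm : Measurable h) (hd : HasDerivAt h h' (T.pathPassRate α k ^ (x.card - 1))) :
    TendstoInDistribution
      (fun (n : ℕ) ω => √n *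
        (h (T.localEstimator Z x n ω) - h (T.pathPassRate α k ^ (x.card - 1))))
      atTop id (fun _ => μ) (gaussianReal 0
        ((h' * T.pathPassRate α k ^ (x.card - 1)) ^ 2 *
          (logVariance x (T.pathPassRate α k) (T.subtreeRate α) / T.pathPassRate α k)).toNNReal) := by
  have hA := (pathPassRate_pos hα k).ne'
  have hβ : ∀ j ∈ x, T.subtreeRate α j ≠ 0 := fun j _ => (subtreeRate_pos hα j).ne'
  have hcy : ∀ y ⊆ x, y.Nonempty →
      T.jointRate α y = T.pathPassRate α k * ∏ j ∈ y, T.subtreeRate α j := fun y hy hy' =>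
    jointRate_eq hα (hy.trans hx) hy'
  have hcne : ∀ y ⊆ x, y.Nonempty → T.jointRate α y ≠ 0 := fun y hy hy' => by
    rw [hcy y hy hy']
    exact mul_ne_zero hA (Finset.prod_ne_zero_iff.2 fun j hj => hβ j (hy hj))
  have hprobe : ∀ i, Measurable fun ω e => Z i e ω := fun i =>
    measurable_pi_lambda _ fun e => hZ.measurable i e
  have hobs : Measurable T.obsVec := Measurable.of_discrete
  have hobsy : ∀ y, Measurable fun z => T.obsVec z y := fun y => Measurable.of_discrete
  set X : ℕ → Ω → Finset V → ℝ := fun i ω => T.obsVec fun e => Z i e ω with hX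
  have hident : ∀ i, IdentDistrib (X i) (X 0) μ μ := fun i =>
    IdentDistrib.comp (f := fun ω e => Z i e ω) (g := fun ω e => Z 0 e ω)
      ⟨(hprobe i).aemeasurable, (hprobe 0).aemeasurable,
        (hZ.map_eq hα i).trans (hZ.map_eq hα 0).symm⟩ hobs
  have hindep : iIndepFun X μ :=
    (iIndepFun_curry (X := Z) hZ.measurable hZ.indep).comp (fun _ => T.obsVec) fun _ => hobs
  have hint : ∀ y, ∫ ω, X 0 ω y ∂μ = T.jointRate α y := fun y => by
    rw [← integral_obsVec, ← hZ.map_eq hα 0,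
      integral_map (hprobe 0).aemeasurable (hobsy y).aestronglyMeasurable]
  have hmem : ∀ y, MemLp (fun ω => X 0 ω y) 2 μ := fun y => by
    have h1 := memLp_obsVec α y
    rw [← hZ.map_eq hα 0] at h1
    exact h1.comp_of_map (hprobe 0).aemeasurable
  have hval := prod_jointRate_div hα hx hne
  have hder : HasFDerivAt (fun p : Finset V → ℝ => h ((∏ j ∈ x, p {j}) / p x))
      (h' • (T.pathPassRate α k ^ (x.card - 1)) • logRatioDeriv x (T.jointRate α))
      (T.jointRate α) := by
    have h1 := hasFDerivAt_prod_div (x := x) (c := T.jointRate α)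
      (fun j hj => hcne {j} (by simpa using hj) (by simp)) (hcne x subset_rfl hne)
    rw [hval] at h1
    rw [← hval] at hd
    exact hd.comp_hasFDerivAt (T.jointRate α) h1
  have hvar : Var[fun ω => (h' • (T.pathPassRate α k ^ (x.card - 1)) •
      logRatioDeriv x (T.jointRate α)) (X 0 ω); μ] = (h' * T.pathPassRate α k ^ (x.card - 1)) ^ 2 *
        (logVariance x (T.pathPassRate α k) (T.subtreeRate α) / T.pathPassRate α k) := by
    rw [← variance_logRatioDeriv (ν := μ) (U := X 0) hmem (fun ω a b => obsVec_mul _ a b) hA hβ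
      (fun y => (hint y).symm) hcy hne, ← variance_const_mul]
    congr 1
    ext ω
    simp [mul_assoc]
  have hmeas : Measurable fun p : Finset V → ℝ => h ((∏ j ∈ x, p {j}) / p x) :=
    hm.comp (by fun_prop)
  have key := tendstoInDistribution_sqrt_mul_comp_mean_sub hmem hindep hident hmeas
    (by simp_rw [hint]; exact hder)
  rw [hvar] at key
  simp_rw [hint, hval] at key
  simp_rw [localEstimator_eq]
  exact key

end Limit

/-! ### Expansion of the variances as the loss rates tend to 0. -/

section Expansion

open Asymptotics

variable (T k x)

theorem tendsto_norm_one_sub :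
    Tendsto (fun α : T.Link → ℝ => ‖fun e => 1 - α e‖) (𝓝[T.passRates] 1) (𝓝 0) := by
  have h : Continuous fun α : T.Link → ℝ => ‖fun e => 1 - α e‖ := by fun_prop
  refine (h.tendsto' 1 0 ?_).mono_left nhdsWithin_le_nhds
  simp [← Pi.zero_def]

theorem one_sub_isBigO (e : T.Link) :
    (fun α : T.Link → ℝ => 1 - α e) =O[𝓝[T.passRates] 1] fun α => ‖fun e => 1 - α e‖ :=
  IsBigO.of_bound 1 (.of_forall fun α => by
    simpa using norm_le_pi_norm (fun e => 1 - α e) e)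

theorem pathLossSum_isBigO :
    (fun α => T.pathLossSum α k) =O[𝓝[T.passRates] 1] fun α => ‖fun e => 1 - α e‖ :=
  IsBigO.fun_sum fun e _ => T.one_sub_isBigO e

theorem pathPassRate_isBigO :
    (fun α => T.pathPassRate α k - 1 + T.pathLossSum α k)
      =O[𝓝[T.passRates] 1] fun α => ‖fun e => 1 - α e‖ ^ 2 :=
  (isBigO_prod_one_sub T.tendsto_norm_one_sub (T.pathLinks k)
    fun e _ => T.one_sub_isBigO e).congr_left fun α => by simp [pathPassRate, pathLossSum]

theorem one_sub_subtreeRate_isBigO (j : V) :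
    (fun α => 1 - T.subtreeRate α j) =O[𝓝[T.passRates] 1] fun α => ‖fun e => 1 - α e‖ := by
  refine IsBigO.trans (IsBigO.of_bound 1 ?_)
    (IsBigO.fun_sum (s := Finset.univ) fun e _ => T.one_sub_isBigO e)
  filter_upwards [self_mem_nhdsWithin] with α hα
  rw [one_mul]
  exact (abs_one_sub_subtreeRate_le hα j).trans (le_abs_self _)

theorem pow_mul_logVariance_isBigO (n : ℕ) :
    (fun α => T.pathPassRate α k ^ n * logVariance x (T.pathPassRate α k) (T.subtreeRate α)
        - ((x.card : ℝ) - 1) ^ 2 * T.pathLossSum α k)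
      =O[𝓝[T.passRates] 1] fun α => ‖fun e => 1 - α e‖ ^ 2 := by
  have hε := T.tendsto_norm_one_sub
  have hs := T.pathLossSum_isBigO k
  refine pow_mul_sub_isBigO hε (hs.const_mul_left _) ?_
    (logVariance_sub_isBigO hε (T.pathPassRate_isBigO k)
      fun j _ => T.one_sub_subtreeRate_isBigO j) n
  exact isBigO_self_of_sq hε hs.neg_left ((T.pathPassRate_isBigO k).congr_left fun α => by ring)

end Expansion

end MulticastTree

/-! ### The two limits and their variances. -/

theorem mainTheorem9 {V : Type*} [Fintype V] [DecidableEq V] (T : MulticastTree V) (k : V)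
    (x : Finset V) (hx : x ⊆ T.children k) (hx2 : 2 ≤ x.card) :
    (∃ v : (T.Link → ℝ) → ℝ≥0,
      (∀ α ∈ T.passRates, ∀ (Ω : Type*) [MeasurableSpace Ω] (μ : Measure Ω)
          [IsProbabilityMeasure μ] (Z : ℕ → T.Link → Ω → Bool), T.IsLossModel Z μ α →
        TendstoInDistribution
          (fun (n : ℕ) (ω : Ω) => Real.sqrt n *
            (T.localEstimator Z x n ω ^ (1 / ((x.card : ℝ) - 1)) - T.pathPassRate α k))
          atTop id (fun _ => μ) (gaussianReal 0 (v α))) ∧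
      (fun α => (v α : ℝ) - T.pathLossSum α k)
        =O[𝓝[T.passRates] 1] fun α => ‖fun e => 1 - α e‖ ^ 2) ∧
    (∃ w : (T.Link → ℝ) → ℝ≥0,
      (∀ α ∈ T.passRates, ∀ (Ω : Type*) [MeasurableSpace Ω] (μ : Measure Ω)
          [IsProbabilityMeasure μ] (Z : ℕ → T.Link → Ω → Bool), T.IsLossModel Z μ α →
        TendstoInDistribution
          (fun (n : ℕ) (ω : Ω) => Real.sqrt n *
            (T.localEstimator Z x n ω - T.pathPassRate α k ^ (x.card - 1)))
          atTop id (fun _ => μ) (gaussianReal 0 (w α))) ∧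
      (fun α => (w α : ℝ) - ((x.card : ℝ) - 1) ^ 2 * T.pathLossSum α k)
        =O[𝓝[T.passRates] 1] fun α => ‖fun e => 1 - α e‖ ^ 2) := by
  have hne : x.Nonempty := Finset.card_pos.1 (by lia)
  obtain ⟨m, hm⟩ : ∃ m, x.card = m + 2 := Nat.exists_eq_add_of_le' hx2
  have hm1 : (x.card : ℝ) - 1 = m + 1 := by
    rw [hm]
    push_cast
    ring
  have hm0 : (0 : ℝ) < (x.card : ℝ) - 1 := by
    rw [hm1]
    positivity
  -- With `L = A ^ (#x - 1)` the limit variance is `(h' L * L)² * logVariance / A`. For the root `h'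
  -- L * L = A / (#x - 1)`, leaving one factor `A`; for the identity it is `L`, leaving `A ^ (2(#x -
  -- 1) - 1) = A ^ (2m + 1)`.
  refine ⟨⟨fun α => (T.pathPassRate α k ^ 1 *
      logVariance x (T.pathPassRate α k) (T.subtreeRate α) / ((x.card : ℝ) - 1) ^ 2).toNNReal,
      fun α hα Ω _ μ _ Z hZ => ?_, ?_⟩,
    ⟨fun α => (T.pathPassRate α k ^ (2 * m + 1) *
      logVariance x (T.pathPassRate α k) (T.subtreeRate α)).toNNReal,
      fun α hα Ω _ μ _ Z hZ => ?_, ?_⟩⟩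
  · have hA := MulticastTree.pathPassRate_pos hα k
    set A := T.pathPassRate α k with hAdef
    have hroot : (A ^ (x.card - 1)) ^ (1 / ((x.card : ℝ) - 1)) = A := by
      have : (x.card : ℝ) - 1 = ((x.card - 1 : ℕ) : ℝ) := by
        rw [Nat.cast_sub (by lia), Nat.cast_one]
      rw [this, one_div, Real.pow_rpow_inv_natCast hA.le (by lia)]
    have hL : A ^ (x.card - 1) ≠ 0 := (pow_pos hA _).ne'
    have key := hZ.tendstoInDistribution_comp_localEstimator hα hx hne
      (h := fun t => t ^ (1 / ((x.card : ℝ) - 1))) (by fun_prop)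
      (Real.hasDerivAt_rpow_const (Or.inl hL))
    have hvar : (1 / ((x.card : ℝ) - 1) * (A ^ (x.card - 1)) ^ (1 / ((x.card : ℝ) - 1) - 1) *
        A ^ (x.card - 1)) ^ 2 * (logVariance x A (T.subtreeRate α) / A) =
        A ^ 1 * logVariance x A (T.subtreeRate α) / ((x.card : ℝ) - 1) ^ 2 := by
      rw [mul_assoc, Real.rpow_sub_one hL, div_mul_cancel₀ _ hL, hroot]
      field_simp
    simp only [← hAdef, hvar, hroot] at key
    exact key
  · refine toNNReal_sub_isBigO (T.eventually_pathLossSum_nonneg k) ?_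
    refine ((T.pow_mul_logVariance_isBigO k x 1).const_mul_left
      (((x.card : ℝ) - 1) ^ 2)⁻¹).congr_left fun α => ?_
    field_simp
  · have hA := MulticastTree.pathPassRate_pos hα k
    have key := hZ.tendstoInDistribution_comp_localEstimator hα hx hne (h := id) measurable_id
      (hasDerivAt_id _)
    have hvar : (1 * T.pathPassRate α k ^ (x.card - 1)) ^ 2 *
        (logVariance x (T.pathPassRate α k) (T.subtreeRate α) / T.pathPassRate α k) =
        T.pathPassRate α k ^ (2 * m + 1) *
          logVariance x (T.pathPassRate α k) (T.subtreeRate α) := by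
      rw [show x.card - 1 = m + 1 by lia]
      field_simp
      ring
    rw [hvar] at key
    exact key
  · exact toNNReal_sub_isBigO ((T.eventually_pathLossSum_nonneg k).mono fun α h => by positivity)
      (T.pow_mul_logVariance_isBigO k x _)
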